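/- Let $W\colon\{0,1\}\to\mathbb{C}^{d\times d}$, $x\mapsto\rho^x$, be a binary-input symmetric classical-quantum channel: $\rho^0,\rho^1$ are density matrices and $\rho^1=U\rho^0U^\dagger$ for some unitary $U$ with $U^2=\mathbb{I}$. Let $r,m\ge 0$ be integers, $N=2^m$, and let $\mathcal{C}=\mathrm{RM}(r,m)\subseteq\mathbb{F}_2^N$ be the Reed--Muller code, i.e. the set of evaluations at all points of $\mathbb{F}_2^m$ (position $\ell\in\{0,\dots,N-1\}$ corresponding to the binary expansion of $\ell$) of multilinear polynomials in $m$ variables over $\mathbb{F}_2$ of total degree at most $r$. Let $\boldsymbol{X}=(X_0,\dots,X_{N-1})$ be uniform on $\mathcal{C}$, let each bit be sent through an independent copy of $W$, and let $Y_{\sim 0}$ be the output systems at all positions other than $0$, so that $$\rho_{X_0Y_{\sim 0}}=\frac1{|\mathcal{C}|}\sum_{\boldsymbol{x}\in\mathcal{C}}|x_0\rangle\langle x_0|\otimes\bigotimes_{i\neq 0}\rho^{x_i}.$$ Let $H=H(X_0|Y_{\sim 0})=S(\rho_{X_0Y_{\sim 0}})-S(\rho_{Y_{\sim 0}})$, where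 $S(\rho)=-\mathrm{Tr}(\rho\log_2\rho)$. For a Hermitian matrix $M$ on $Y_{\sim 0}$ put $$f(M)=\mathrm{Tr}\Big(\rho_{X_0Y_{\sim 0}}\big((|0\rangle\langle 0|-|1\rangle\langle 1|)\otimes\mathbb{I}-\mathbb{I}\otimes M\big)^2\Big),$$ and let $\mathcal{M}(X_0|Y_{\sim 0})=\inf_M f(M)$, the infimum being over all Hermitian $M$, be the minimum mean-squared error (MMSE). Then $$\mathcal{M}(X_0|Y_{\sim 0})\le 4\cdot 2^{-H}\,(1-2^{-H}),$$ and for every real $\delta\ge 0$, if $H\le 1-\frac{\delta}{\ln 2}$, then $\mathcal{M}(X_0|Y_{\sim 0})\le 1-\delta^2$. Moreover, both assertions also hold with $\mathcal{M}(X_0|Y_{\sim 0})$ replaced by $f(M^*)$ for every observable $M^*$ of the form $M^*=V\,\mathrm{diag}(d_i/p_i)\,V^\dagger$, where $D=\langle 0|\rho_{X_0Y_{\sim 0}}|0\rangle-\langle 1|\rho_{X_0Y_{\sim 0}}|1\rangle=V\,\mathrm{diag}(d_i)\,V^\dagger$ is a spectral decomposition ($V$ unitary, $d_i$ real) and $p_i=(V^\dagger\rho_{Y_{\sim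 0}}V)_{ii}$ (with $d_i/p_i$ read as $0$ if $p_i=0$). -/

import Mathlib

open scoped Matrix Kronecker ComplexOrder

noncomputable section

namespace RMCQ

/-! ### Quantum states and binary-input symmetric classical-quantum channels -/

/-- Density matrices: positive semidefinite matrices of unit trace. -/
def IsDensity {ι : Type*} [Fintype ι] (ρ : Matrix ι ι ℂ) : Prop :=
  ρ.PosSemidef ∧ ρ.trace = 1

/-- A binary-input classical-quantum channel `x ↦ W x` with outputs in `ℂ^(d × d)` is *symmetric*
(a BSCQ channel) if its outputs are density matrices and `W 1 = U (W 0) U†` for a unitary `U`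
with `U² = 1`. -/
structure IsBSCQ {d : ℕ} (W : ZMod 2 → Matrix (Fin d) (Fin d) ℂ) : Prop where
  density : ∀ x, IsDensity (W x)
  symmetric : ∃ U ∈ Matrix.unitaryGroup (Fin d) ℂ, U * U = 1 ∧ W 1 = U * W 0 * Uᴴ

/-- The tensor product `⨂ᵢ A i` of a finite family of matrices, as a matrix indexed by tuples. -/
def tensorFamily {I J : Type*} [Fintype I] (A : I → Matrix J J ℂ) : Matrix (I → J) (I → J) ℂ :=
  Matrix.of fun a b => ∏ i, A i (a i) (b i)

/-! ### Reed--Muller codes -/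

/-- The point of `𝔽₂^m` given by the binary expansion of `l < 2^m` (coordinate `j` is bit `j`). -/
def binaryPoint (m : ℕ) (l : Fin (2 ^ m)) : Fin m → ZMod 2 :=
  fun j => if (l : ℕ).testBit j then 1 else 0

/-- The Reed--Muller code `RM(r, m)` of length `2^m`: the evaluations, at all points of `𝔽₂^m`,
of the multilinear polynomials in `m` variables over `𝔽₂` of total degree at most `r`. -/
def reedMuller (r m : ℕ) : Submodule (ZMod 2) (Fin (2 ^ m) → ZMod 2) :=
  (MvPolynomial.restrictTotalDegree (Fin m) (ZMod 2) r ⊓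
      MvPolynomial.restrictDegree (Fin m) (ZMod 2) 1).map
    (LinearMap.pi fun l : Fin (2 ^ m) => (MvPolynomial.aeval (binaryPoint m l)).toLinearMap)

/-! ### The extrinsic classical-quantum state -/

/-- Index type of the joint system `Y_{∼0}`, i.e. of `n = N - 1` qudits of dimension `d` placed at
the non-zero positions. -/
abbrev ExtrinsicIdx (N d : ℕ) [NeZero N] : Type := {i : Fin N // i ≠ 0} → Fin d

/-- The channel output `⨂_{i ≠ 0} W (x i)` on the systems `Y_{∼0}` for the channel input `x`. -/
def extrinsicOutput {N d : ℕ} [NeZero N] (W : ZMod 2 → Matrix (Fin d) (Fin d) ℂ)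
    (x : Fin N → ZMod 2) : Matrix (ExtrinsicIdx N d) (ExtrinsicIdx N d) ℂ :=
  tensorFamily fun i : {i : Fin N // i ≠ 0} => W (x i)

open Classical in
/-- The state `ρ_{X₀ Y_{∼0}} = |C|⁻¹ ∑_{x ∈ C} |x₀⟩⟨x₀| ⊗ (⨂_{i ≠ 0} W (x i))` of the bit `X₀` of a
uniformly random codeword together with the outputs at all positions other than `0`. -/
def extrinsicState {N d : ℕ} [NeZero N] (W : ZMod 2 → Matrix (Fin d) (Fin d) ℂ)
    (C : Submodule (ZMod 2) (Fin N → ZMod 2)) :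
    Matrix (ZMod 2 × ExtrinsicIdx N d) (ZMod 2 × ExtrinsicIdx N d) ℂ :=
  (Nat.card C : ℂ)⁻¹ •
    ∑ x : Fin N → ZMod 2 with x ∈ C,
      Matrix.single (x 0) (x 0) (1 : ℂ) ⊗ₖ extrinsicOutput W x

/-! ### Entropies (in bits) -/

/-- The von Neumann entropy `S(ρ) = -Tr (ρ log₂ ρ)`, with the convention `0 log₂ 0 = 0`. -/
def entropy {ι : Type*} [Fintype ι] [DecidableEq ι] (ρ : Matrix ι ι ℂ) : ℝ :=
  -(ρ * cfc (Real.logb 2) ρ).trace.re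

/-- The partial trace `ρ_Y = Tr_X ρ_{XY}`. -/
def traceX {X Y : Type*} [Fintype X] (ρ : Matrix (X × Y) (X × Y) ℂ) : Matrix Y Y ℂ :=
  Matrix.of fun a b => ∑ x, ρ (x, a) (x, b)

/-- The conditional entropy `H(X|Y) = S(ρ_{XY}) - S(ρ_Y)`. -/
def condEntropy {X Y : Type*} [Fintype X] [DecidableEq X] [Fintype Y] [DecidableEq Y]
    (ρ : Matrix (X × Y) (X × Y) ℂ) : ℝ :=
  entropy ρ - entropy (traceX ρ)

/-! ### Minimum mean-squared error for a bit `X` given a quantum system `Y` -/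

variable {Y : Type*} [Fintype Y] [DecidableEq Y]

/-- The observable `|0⟩⟨0| - |1⟩⟨1|` of the bit. -/
def signObservable : Matrix (ZMod 2) (ZMod 2) ℂ :=
  Matrix.single 0 0 1 - Matrix.single 1 1 1

/-- The mean-squared error `Tr (ρ_{XY} (O_X - O_Y)²)`, where `O_X = (|0⟩⟨0| - |1⟩⟨1|) ⊗ 1` and
`O_Y = 1 ⊗ M`. -/
def mse (ρ : Matrix (ZMod 2 × Y) (ZMod 2 × Y) ℂ) (M : Matrix Y Y ℂ) : ℝ :=
  (ρ * (signObservable ⊗ₖ (1 : Matrix Y Y ℂ) - (1 : Matrix (ZMod 2) (ZMod 2) ℂ) ⊗ₖ M) ^ 2).trace.re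

/-- The minimum mean-squared error of `X` given `Y`: the infimum of the mean-squared error over all
observables (Hermitian matrices) `M` on `Y`. -/
def mmse (ρ : Matrix (ZMod 2 × Y) (ZMod 2 × Y) ℂ) : ℝ :=
  sInf (mse ρ '' {M : Matrix Y Y ℂ | M.IsHermitian})

/-- The operator `D = ⟨0|ρ_{XY}|0⟩ - ⟨1|ρ_{XY}|1⟩` on `Y`. -/
def diffOperator (ρ : Matrix (ZMod 2 × Y) (ZMod 2 × Y) ℂ) : Matrix Y Y ℂ :=
  Matrix.of fun a b => ρ (0, a) (0, b) - ρ (1, a) (1, b)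

/-- `M` is an observable `V diag(dᵢ / pᵢ) V†` built from a spectral decomposition
`D = V diag(dᵢ) V†` and from `pᵢ = (V† ρ_Y V)ᵢᵢ`; here `dᵢ / pᵢ` is read as `0` when `pᵢ = 0`
(in which case `dᵢ = 0` as well). -/
def IsSpectralObservable (ρ : Matrix (ZMod 2 × Y) (ZMod 2 × Y) ℂ) (M : Matrix Y Y ℂ) : Prop :=
  ∃ V ∈ Matrix.unitaryGroup Y ℂ, ∃ e : Y → ℝ,
    diffOperator ρ = V * Matrix.diagonal (fun i => (e i : ℂ)) * Vᴴ ∧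
    M = V * Matrix.diagonal (fun i => (e i : ℂ) / (Vᴴ * traceX ρ * V) i i) * Vᴴ

end RMCQ

end

/-!
Write the extrinsic state as `ρ = |0⟩⟨0| ⊗ A + |1⟩⟨1| ⊗ B` with `A`, `B` positive semidefinite and
`Tr (A + B) = 1`. The bounds hold for every state of this form.

The link between the mean-squared error and the entropy is the number
`g = (1 + ‖A - B‖₁) / 2`, the success probability of the optimal guess of the bit.

* Let `A - B = V diag(eᵢ) V†` and `pᵢ = (V† (A + B) V)ᵢᵢ`, so that `∑ pᵢ = 1`. The spectral
  observable has mean-squared error `1 - ∑ eᵢ² / pᵢ`, and by the Cauchy–Schwarz inequality this is at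
  most `1 - (∑ |eᵢ|)² = 4 g (1 - g)` (`mse_le_of_isSpectralObservable`).
* `H ≥ -log₂ g`, that is, `2 ^ (-H) ≤ g`: the operator `σ = B + (A - B)₊` dominates both `A` and `B`
  and has trace `g` (`exists_common_upper_bound`). Operator monotonicity of the logarithm gives
  `Tr A log A ≤ Tr A log σ` and the same for `B`, and Klein's inequality compares
  `Tr (A + B) log σ` with `Tr (A + B) log (A + B)` (`le_lnEntropy_add_sub`).
* `H ≤ 1`, by Klein's inequality for `A` and `B` against `(A + B) / 2` (`lnEntropy_add_sub_le`).

As `1 / 2 ≤ 2 ^ (-H) ≤ g` and `t ↦ 4 t (1 - t)` decreases on `[1 / 2, ∞)`, the first bound follows.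
If `H ≤ 1 - δ / ln 2`, then `g ≥ 2 ^ (-H) ≥ exp δ / 2 ≥ (1 + δ) / 2`, hence
`4 g (1 - g) = 1 - (2 g - 1)² ≤ 1 - δ²`.

The entropy inequalities are proved for positive definite matrices, and extended to the positive
semidefinite case by adding `t • 1` and letting `t` tend to `0`.
-/

namespace RMCQ

/-! ### Functional calculus in an eigenbasis -/

section Spectral

variable {n : Type*} [Fintype n]

/-- The transition weights `|(V† U)ᵢⱼ|²` between two orthonormal bases. -/
def overlap (V U : Matrix n n ℂ) (i j : n) : ℝ := Complex.normSq ((Vᴴ * U) i j)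

lemma overlap_nonneg (V U : Matrix n n ℂ) (i j : n) : 0 ≤ overlap V U i j :=
  Complex.normSq_nonneg _

lemma overlap_comm (V U : Matrix n n ℂ) (i j : n) : overlap V U i j = overlap U V j i := by
  have : (Vᴴ * U) i j = star ((Uᴴ * V) j i) := by
    rw [← Matrix.conjTranspose_apply, Matrix.conjTranspose_mul, Matrix.conjTranspose_conjTranspose]
  rw [overlap, overlap, this, Complex.star_def, Complex.normSq_conj]

variable [DecidableEq n]

lemma unitary_conjTranspose_mul {V : Matrix n n ℂ} (hV : V ∈ Matrix.unitaryGroup n ℂ) :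
    Vᴴ * V = 1 := Matrix.mem_unitaryGroup_iff'.1 hV

lemma unitary_mul_conjTranspose {V : Matrix n n ℂ} (hV : V ∈ Matrix.unitaryGroup n ℂ) :
    V * Vᴴ = 1 := Matrix.mem_unitaryGroup_iff.1 hV

lemma exists_spectral {A : Matrix n n ℂ} (hA : A.IsHermitian) :
    ∃ V ∈ Matrix.unitaryGroup n ℂ, ∃ e : n → ℝ,
      A = V * Matrix.diagonal (fun i => (e i : ℂ)) * Vᴴ := by
  refine ⟨hA.eigenvectorUnitary, hA.eigenvectorUnitary.2, hA.eigenvalues, ?_⟩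
  have h := hA.spectral_theorem
  rw [Unitary.conjStarAlgAut_apply] at h
  exact h

lemma trace_conj_diagonal {V : Matrix n n ℂ} (hV : V ∈ Matrix.unitaryGroup n ℂ) (e : n → ℝ) :
    (V * Matrix.diagonal (fun i => (e i : ℂ)) * Vᴴ).trace = ∑ i, (e i : ℂ) := by
  rw [Matrix.trace_mul_comm, ← mul_assoc, unitary_conjTranspose_mul hV, one_mul,
    Matrix.trace_diagonal]

lemma conj_diagonal_mul {V : Matrix n n ℂ} (hV : V ∈ Matrix.unitaryGroup n ℂ) (a b : n → ℂ) :
    (V * Matrix.diagonal a * Vᴴ) * (V * Matrix.diagonal b * Vᴴ)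
      = V * Matrix.diagonal (fun i => a i * b i) * Vᴴ := by
  rw [← Matrix.diagonal_mul_diagonal]
  calc _ = V * Matrix.diagonal a * (Vᴴ * V) * Matrix.diagonal b * Vᴴ := by
        simp only [mul_assoc]
    _ = _ := by rw [unitary_conjTranspose_mul hV, mul_one]; simp only [mul_assoc]

lemma isHermitian_conj_diagonal (V : Matrix n n ℂ) (e : n → ℝ) :
    (V * Matrix.diagonal (fun i => (e i : ℂ)) * Vᴴ).IsHermitian :=
  Matrix.isHermitian_mul_mul_conjTranspose V (by
    rw [Matrix.isHermitian_diagonal_iff]; intro i; simp [IsSelfAdjoint])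

/-- The functional calculus of a Hermitian matrix can be computed in any of its eigenbases. -/
lemma cfc_conj_diagonal {V : Matrix n n ℂ} (hV : V ∈ Matrix.unitaryGroup n ℂ) (e : n → ℝ)
    (f : ℝ → ℝ) :
    cfc f (V * Matrix.diagonal (fun i => (e i : ℂ)) * Vᴴ)
      = V * Matrix.diagonal (fun i => (f (e i) : ℂ)) * Vᴴ := by
  -- Real functions on `n` act as the operators diagonal in the basis `V`.
  let φ : (n → ℝ) →⋆ₐ[ℝ] Matrix n n ℂ :=
    { toFun := fun e => V * Matrix.diagonal (fun i => (e i : ℂ)) * Vᴴ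
      map_one' := by simp [unitary_mul_conjTranspose hV]
      map_zero' := by simp
      map_mul' := fun a b => by rw [conj_diagonal_mul hV]; simp
      map_add' := fun a b => by
        rw [← add_mul, ← mul_add, Matrix.diagonal_add]; simp
      commutes' := fun r => by
        have : Matrix.diagonal (fun i : n => ((algebraMap ℝ (n → ℝ) r i : ℝ) : ℂ))
            = algebraMap ℝ (Matrix n n ℂ) r := by
          rw [Matrix.algebraMap_eq_diagonal]; rfl
        rw [this, ← Algebra.commutes, mul_assoc, unitary_mul_conjTranspose hV, mul_one]
      map_star' := fun a => by
        rw [Matrix.star_eq_conjTranspose, (isHermitian_conj_diagonal V a).eq]; simp }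
  -- On the finite spectrum of `φ e` the function `f` agrees with a polynomial.
  let s : Finset ℝ := Finset.univ.image e
  let p : Polynomial ℝ := Lagrange.interpolate s id f
  have hp : ∀ i, p.eval (e i) = f (e i) := fun i =>
    Lagrange.eval_interpolate_at_node (v := id) f (Function.injective_id.injOn)
      (Finset.mem_image_of_mem e (Finset.mem_univ i))
  have hspec : Set.EqOn f p.eval (spectrum ℝ (φ e)) := by
    intro x hx
    have hx' := AlgHom.spectrum_apply_subset φ.toAlgHom e hx
    rw [Pi.spectrum_eq, Set.mem_iUnion] at hx'
    obtain ⟨i, hi⟩ := hx'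
    have hx'' : x = e i := by
      simpa using (spectrum.scalar_eq (A := ℝ) (e i) ▸ hi : x ∈ ({e i} : Set ℝ))
    rw [hx'']; exact (hp i).symm
  have hsa : IsSelfAdjoint (φ e) := (IsSelfAdjoint.all e).map φ
  have h : cfc f (φ e) = φ (Polynomial.aeval e p) := by
    rw [cfc_congr hspec, cfc_polynomial p (φ e) hsa]
    exact Polynomial.aeval_algHom_apply φ.toAlgHom e p
  have h2 : Polynomial.aeval e p = fun i => f (e i) := by
    funext i
    rw [Polynomial.aeval_fn_apply, ← hp i, Polynomial.coe_aeval_eq_eval]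
  rw [h2] at h
  exact h

lemma re_trace_conj_diagonal_mul (V U : Matrix n n ℂ) (a b : n → ℝ) :
    ((V * Matrix.diagonal (fun i => (a i : ℂ)) * Vᴴ) *
      (U * Matrix.diagonal (fun i => (b i : ℂ)) * Uᴴ)).trace.re
      = ∑ i, ∑ j, a i * b j * overlap V U i j := by
  have h : ((V * Matrix.diagonal (fun i => (a i : ℂ)) * Vᴴ) *
      (U * Matrix.diagonal (fun i => (b i : ℂ)) * Uᴴ)).trace
      = (Matrix.diagonal (fun i => (a i : ℂ)) * (Vᴴ * U) *
          Matrix.diagonal (fun i => (b i : ℂ)) * (Vᴴ * U)ᴴ).trace := by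
    rw [Matrix.conjTranspose_mul, Matrix.conjTranspose_conjTranspose, ← mul_assoc _ Uᴴ V,
      Matrix.trace_mul_comm _ V]
    simp only [mul_assoc]
  rw [h, Matrix.trace, Complex.re_sum]
  refine Finset.sum_congr rfl fun i _ => ?_
  rw [Matrix.diag_apply, Matrix.mul_apply, Complex.re_sum]
  refine Finset.sum_congr rfl fun j _ => ?_
  rw [Matrix.mul_diagonal, Matrix.diagonal_mul, Matrix.conjTranspose_apply]
  have : (a i : ℂ) * (Vᴴ * U) i j * (b j : ℂ) * star ((Vᴴ * U) i j)
      = ((a i * b j * overlap V U i j : ℝ) : ℂ) := by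
    rw [overlap]; push_cast; rw [← Complex.mul_conj]; simp only [Complex.star_def]; ring
  rw [this, Complex.ofReal_re]

lemma re_trace_conj_diagonal {V : Matrix n n ℂ} (hV : V ∈ Matrix.unitaryGroup n ℂ) (e : n → ℝ) :
    (V * Matrix.diagonal (fun i => (e i : ℂ)) * Vᴴ).trace.re = ∑ i, e i := by
  rw [trace_conj_diagonal hV, Complex.re_sum]; simp

lemma sum_overlap_right {V U : Matrix n n ℂ} (hV : V ∈ Matrix.unitaryGroup n ℂ)
    (hU : U ∈ Matrix.unitaryGroup n ℂ) (i : n) : ∑ j, overlap V U i j = 1 := by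
  have h : ((Vᴴ * U) * (Vᴴ * U)ᴴ) i i = 1 := by
    rw [Matrix.conjTranspose_mul, Matrix.conjTranspose_conjTranspose, mul_assoc, ← mul_assoc U,
      unitary_mul_conjTranspose hU, one_mul, unitary_conjTranspose_mul hV, Matrix.one_apply_eq]
  rw [Matrix.mul_apply] at h
  have h' := congrArg Complex.re h
  rw [Complex.re_sum, Complex.one_re] at h'
  rw [← h']
  refine Finset.sum_congr rfl fun j _ => ?_
  rw [overlap, Matrix.conjTranspose_apply, Complex.star_def, Complex.mul_conj, Complex.ofReal_re]

lemma sum_overlap_left {V U : Matrix n n ℂ} (hV : V ∈ Matrix.unitaryGroup n ℂ)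
    (hU : U ∈ Matrix.unitaryGroup n ℂ) (j : n) : ∑ i, overlap V U i j = 1 := by
  simp only [overlap_comm V U]
  exact sum_overlap_right hU hV j

lemma conj_diagonal_conj {V : Matrix n n ℂ} (hV : V ∈ Matrix.unitaryGroup n ℂ) (e : n → ℂ) :
    Vᴴ * (V * Matrix.diagonal e * Vᴴ) * V = Matrix.diagonal e := by
  calc _ = (Vᴴ * V) * Matrix.diagonal e * (Vᴴ * V) := by simp only [mul_assoc]
    _ = _ := by rw [unitary_conjTranspose_mul hV, one_mul, mul_one]

lemma eigenvalues_pos_of_posDef {V : Matrix n n ℂ} (hV : V ∈ Matrix.unitaryGroup n ℂ)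
    {e : n → ℝ} (h : (V * Matrix.diagonal (fun i => (e i : ℂ)) * Vᴴ).PosDef) (i : n) :
    0 < e i := by
  have h' := h.conjTranspose_mul_mul_same (B := V) (by
    refine Function.LeftInverse.injective (g := Vᴴ.mulVec) fun x => ?_
    rw [Matrix.mulVec_mulVec, unitary_conjTranspose_mul hV, Matrix.one_mulVec])
  rw [conj_diagonal_conj hV, Matrix.posDef_diagonal_iff] at h'
  exact_mod_cast h' i

end Spectral

/-! ### Entropy inequalities for positive definite matrices -/

section Klein

variable {n : Type*} [Fintype n] [DecidableEq n]

/-- The scalar inequality behind Klein's inequality, a form of `log x ≤ x - 1`. -/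
lemma log_klein {a b : ℝ} (ha : 0 < a) (hb : 0 < b) : a - b ≤ a * (Real.log a - Real.log b) := by
  have h := Real.log_le_sub_one_of_pos (div_pos hb ha)
  rw [Real.log_div hb.ne' ha.ne'] at h
  have h2 := mul_le_mul_of_nonneg_left h ha.le
  have h3 : a * (b / a - 1) = b - a := by field_simp
  linarith

/-- **Klein's inequality**, for the pair `A`, `c • B`. -/
lemma klein {A B : Matrix n n ℂ} (hA : A.PosDef) (hB : B.PosDef) {c : ℝ} (hc : 0 < c) :
    A.trace.re - c * B.trace.re ≤ (A * cfc Real.log A).trace.re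
      - (A * cfc Real.log B).trace.re - Real.log c * A.trace.re := by
  obtain ⟨V, hV, a, rfl⟩ := exists_spectral hA.isHermitian
  obtain ⟨U, hU, b, rfl⟩ := exists_spectral hB.isHermitian
  have ha := eigenvalues_pos_of_posDef hV hA
  have hb := eigenvalues_pos_of_posDef hU hB
  rw [cfc_conj_diagonal hV, cfc_conj_diagonal hU, re_trace_conj_diagonal_mul V U,
    conj_diagonal_mul hV, re_trace_conj_diagonal hV, re_trace_conj_diagonal hU]
  have e1 : (V * Matrix.diagonal (fun i => (a i : ℂ) * (Real.log (a i) : ℂ)) * Vᴴ).trace.re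
      = ∑ i, a i * Real.log (a i) := by
    rw [← re_trace_conj_diagonal hV]; simp only [Complex.ofReal_mul]
  rw [e1]
  have r : ∀ f : n → ℝ, ∑ i, f i = ∑ i, ∑ j, f i * overlap V U i j := fun f =>
    Finset.sum_congr rfl fun i _ => by rw [← Finset.mul_sum, sum_overlap_right hV hU, mul_one]
  have l : ∑ j, b j = ∑ i, ∑ j, b j * overlap V U i j := by
    rw [Finset.sum_comm]
    exact Finset.sum_congr rfl fun i _ => by
      rw [← Finset.mul_sum, sum_overlap_left hV hU, mul_one]
  -- All sums run over `i` and `j` with weights `overlap V U i j`, and are compared termwise.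
  rw [r a, r fun i => a i * Real.log (a i), l]
  simp only [Finset.mul_sum, ← Finset.sum_sub_distrib]
  refine Finset.sum_le_sum fun i _ => Finset.sum_le_sum fun j _ => ?_
  have h := log_klein (ha i) (mul_pos hc (hb j))
  rw [Real.log_mul hc.ne' (hb j).ne'] at h
  nlinarith [mul_le_mul_of_nonneg_right h (overlap_nonneg V U i j)]

lemma exists_eq_conjTranspose_mul_self {A : Matrix n n ℂ} (hA : A.PosSemidef) :
    ∃ B : Matrix n n ℂ, A = Bᴴ * B := by
  open scoped MatrixOrder Matrix.Norms.L2Operator in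
  exact CStarAlgebra.nonneg_iff_eq_star_mul_self.1 hA.nonneg

lemma re_trace_mul_mono {A P Q : Matrix n n ℂ} (hA : A.PosSemidef) (h : (Q - P).PosSemidef) :
    (A * P).trace.re ≤ (A * Q).trace.re := by
  obtain ⟨B, rfl⟩ := exists_eq_conjTranspose_mul_self hA
  have := (h.mul_mul_conjTranspose_same B).trace_nonneg
  rw [mul_sub, sub_mul, Matrix.trace_sub] at this
  have h2 := (Complex.le_def.1 this).1
  rw [Complex.zero_re, Complex.sub_re, Matrix.trace_mul_comm, ← mul_assoc,
    Matrix.trace_mul_comm (B * P), ← mul_assoc] at h2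
  linarith

open scoped MatrixOrder Matrix.Norms.L2Operator in
/-- The logarithm is operator monotone on positive definite matrices. -/
lemma posSemidef_log_sub_log {A B : Matrix n n ℂ} (hA : A.PosDef) (h : (B - A).PosSemidef) :
    (cfc Real.log B - cfc Real.log A).PosSemidef :=
  CFC.log_le_log (A := Matrix n n ℂ) (a := A) (b := B) h
    (Matrix.isStrictlyPositive_iff_posDef.2 hA)

end Klein

/-! ### Bounds on `S(A) + S(B) - S(A + B)` -/

section EntropyBounds

open Filter Topology

variable {n : Type*} [DecidableEq n]

lemma posDef_add_smul_one {A : Matrix n n ℂ} (hA : A.PosSemidef) {t : ℝ} (ht : 0 < t) :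
    (A + (t : ℂ) • 1).PosDef :=
  Matrix.PosDef.posSemidef_add hA (Matrix.PosDef.one.smul (by exact_mod_cast ht))

lemma add_smul_one_add (A B : Matrix n n ℂ) (t : ℝ) :
    (A + ((1 * t : ℝ) : ℂ) • (1 : Matrix n n ℂ)) + (B + ((1 * t : ℝ) : ℂ) • (1 : Matrix n n ℂ))
      = A + B + ((2 * t : ℝ) : ℂ) • (1 : Matrix n n ℂ) := by
  push_cast
  rw [two_mul, one_mul, add_smul]; abel

variable [Fintype n]

/-- The von Neumann entropy in nats. -/
noncomputable def lnEntropy (A : Matrix n n ℂ) : ℝ := -(A * cfc Real.log A).trace.re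

lemma lnEntropy_conj_diagonal {V : Matrix n n ℂ} (hV : V ∈ Matrix.unitaryGroup n ℂ) (e : n → ℝ) :
    lnEntropy (V * Matrix.diagonal (fun i => (e i : ℂ)) * Vᴴ) = ∑ i, Real.negMulLog (e i) := by
  rw [lnEntropy, cfc_conj_diagonal hV, conj_diagonal_mul hV]
  simp only [← Complex.ofReal_mul]
  rw [re_trace_conj_diagonal hV, ← Finset.sum_neg_distrib]
  simp [Real.negMulLog]

lemma entropy_conj_diagonal {V : Matrix n n ℂ} (hV : V ∈ Matrix.unitaryGroup n ℂ) (e : n → ℝ) :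
    entropy (V * Matrix.diagonal (fun i => (e i : ℂ)) * Vᴴ)
      = (∑ i, Real.negMulLog (e i)) / Real.log 2 := by
  rw [entropy, cfc_conj_diagonal hV, conj_diagonal_mul hV]
  simp only [← Complex.ofReal_mul]
  rw [re_trace_conj_diagonal hV, ← Finset.sum_neg_distrib, Finset.sum_div]
  refine Finset.sum_congr rfl fun i _ => ?_
  rw [Real.negMulLog, Real.logb]; ring

lemma entropy_eq_lnEntropy_div {A : Matrix n n ℂ} (hA : A.IsHermitian) :
    entropy A = lnEntropy A / Real.log 2 := by
  obtain ⟨V, hV, e, rfl⟩ := exists_spectral hA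
  rw [lnEntropy_conj_diagonal hV, entropy_conj_diagonal hV]

lemma smul_one_eq_conj_diagonal {V : Matrix n n ℂ} (hV : V ∈ Matrix.unitaryGroup n ℂ) (t : ℝ) :
    (t : ℂ) • (1 : Matrix n n ℂ) = V * Matrix.diagonal (fun _ => (t : ℂ)) * Vᴴ := by
  rw [← Matrix.smul_one_eq_diagonal]
  simp [unitary_mul_conjTranspose hV]

/-- Adding `c t • 1` to a Hermitian matrix shifts its eigenvalues, and `x ↦ -x log x` is
continuous at `0` as well. -/
lemma tendsto_lnEntropy_add_smul_one {A : Matrix n n ℂ} (hA : A.IsHermitian) (c : ℝ) :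
    Tendsto (fun t : ℝ => lnEntropy (A + ((c * t : ℝ) : ℂ) • 1)) (𝓝[>] 0) (𝓝 (lnEntropy A)) := by
  obtain ⟨V, hV, e, rfl⟩ := exists_spectral hA
  have h : ∀ t : ℝ, lnEntropy (V * Matrix.diagonal (fun i => (e i : ℂ)) * Vᴴ
      + ((c * t : ℝ) : ℂ) • 1) = ∑ i, Real.negMulLog (e i + c * t) := fun t => by
    rw [smul_one_eq_conj_diagonal hV, ← add_mul, ← mul_add, Matrix.diagonal_add]
    simp only [← Complex.ofReal_add]
    rw [lnEntropy_conj_diagonal hV]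
  simp only [h]
  rw [lnEntropy_conj_diagonal hV]
  have hc : Continuous fun t : ℝ => ∑ i, Real.negMulLog (e i + c * t) := by fun_prop
  have := hc.tendsto 0
  simp only [mul_zero, add_zero] at this
  exact this.mono_left nhdsWithin_le_nhds

/-- Klein's inequality for `A` and for `B` against `(A + B) / 2`, summed. -/
lemma lnEntropy_add_sub_le_of_posDef {A B : Matrix n n ℂ} (hA : A.PosDef) (hB : B.PosDef) :
    lnEntropy A + lnEntropy B - lnEntropy (A + B) ≤ Real.log 2 * (A + B).trace.re := by
  have hS := hA.add hB
  have h1 := klein hA hS (c := 1 / 2) (by norm_num)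
  have h2 := klein hB hS (c := 1 / 2) (by norm_num)
  have hl : Real.log (1 / 2) = -Real.log 2 := by rw [one_div, Real.log_inv]
  rw [hl] at h1 h2
  have e1 : ((A + B) * cfc Real.log (A + B)).trace.re
      = (A * cfc Real.log (A + B)).trace.re + (B * cfc Real.log (A + B)).trace.re := by
    rw [add_mul, Matrix.trace_add, Complex.add_re]
  have e2 : (A + B).trace.re = A.trace.re + B.trace.re := by
    rw [Matrix.trace_add, Complex.add_re]
  rw [lnEntropy, lnEntropy, lnEntropy, e1]
  rw [e2] at h1 h2 ⊢
  linarith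

/-- A common upper bound `σ` of `A` and `B` bounds the conditional entropy from below: operator
monotonicity of the logarithm bounds `S(A)` and `S(B)`, and Klein's inequality bounds
`S(A + B)`. -/
lemma le_lnEntropy_add_sub_of_posDef {A B σ : Matrix n n ℂ} (hA : A.PosDef) (hB : B.PosDef)
    (hσ : σ.PosDef) (hAσ : (σ - A).PosSemidef) (hBσ : (σ - B).PosSemidef)
    (hS0 : 0 < (A + B).trace.re) (hσ0 : 0 < σ.trace.re) :
    (A + B).trace.re * Real.log ((A + B).trace.re / σ.trace.re)
      ≤ lnEntropy A + lnEntropy B - lnEntropy (A + B) := by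
  have h1 := re_trace_mul_mono hA.posSemidef (posSemidef_log_sub_log hA hAσ)
  have h2 := re_trace_mul_mono hB.posSemidef (posSemidef_log_sub_log hB hBσ)
  -- The scale `Tr (A + B) / Tr σ` equalizes the two traces in Klein's inequality.
  have h3 := klein (hA.add hB) hσ (div_pos hS0 hσ0)
  rw [div_mul_cancel₀ _ hσ0.ne', sub_self] at h3
  have e1 : ((A + B) * cfc Real.log σ).trace.re
      = (A * cfc Real.log σ).trace.re + (B * cfc Real.log σ).trace.re := by
    rw [add_mul, Matrix.trace_add, Complex.add_re]
  rw [e1] at h3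
  rw [lnEntropy, lnEntropy, lnEntropy]
  linarith

lemma re_trace_add_smul_one (A : Matrix n n ℂ) (t : ℝ) :
    (A + (t : ℂ) • (1 : Matrix n n ℂ)).trace.re = A.trace.re + t * Fintype.card n := by
  simp [Matrix.trace_add, Matrix.trace_smul, Matrix.trace_one]

lemma tendsto_lnEntropy_add_sub {A B : Matrix n n ℂ} (hA : A.PosSemidef) (hB : B.PosSemidef) :
    Tendsto (fun t : ℝ => lnEntropy (A + ((1 * t : ℝ) : ℂ) • 1)
      + lnEntropy (B + ((1 * t : ℝ) : ℂ) • 1) - lnEntropy (A + B + ((2 * t : ℝ) : ℂ) • 1))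
      (𝓝[>] 0) (𝓝 (lnEntropy A + lnEntropy B - lnEntropy (A + B))) :=
  ((tendsto_lnEntropy_add_smul_one hA.isHermitian 1).add
    (tendsto_lnEntropy_add_smul_one hB.isHermitian 1)).sub
    (tendsto_lnEntropy_add_smul_one (hA.add hB).isHermitian 2)

lemma lnEntropy_add_sub_le {A B : Matrix n n ℂ} (hA : A.PosSemidef) (hB : B.PosSemidef) :
    lnEntropy A + lnEntropy B - lnEntropy (A + B) ≤ Real.log 2 * (A + B).trace.re := by
  have hr : Tendsto (fun t : ℝ => Real.log 2 * ((A + B).trace.re + 2 * t * Fintype.card n))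
      (𝓝[>] 0) (𝓝 (Real.log 2 * (A + B).trace.re)) := by
    have hc : Continuous fun t : ℝ => Real.log 2 * ((A + B).trace.re + 2 * t * Fintype.card n) := by
      fun_prop
    have := hc.tendsto 0
    simp only [mul_zero, zero_mul, add_zero] at this
    exact this.mono_left nhdsWithin_le_nhds
  refine le_of_tendsto_of_tendsto (tendsto_lnEntropy_add_sub hA hB) hr ?_
  filter_upwards [self_mem_nhdsWithin] with t ht
  have ht' : 0 < 1 * t := by simpa using ht
  have h := lnEntropy_add_sub_le_of_posDef (posDef_add_smul_one hA ht') (posDef_add_smul_one hB ht')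
  rwa [add_smul_one_add, re_trace_add_smul_one] at h

lemma le_lnEntropy_add_sub {A B σ : Matrix n n ℂ} (hA : A.PosSemidef) (hB : B.PosSemidef)
    (hAσ : (σ - A).PosSemidef) (hBσ : (σ - B).PosSemidef)
    (hS : (A + B).trace.re = 1) (hσ0 : 0 < σ.trace.re) :
    -Real.log σ.trace.re ≤ lnEntropy A + lnEntropy B - lnEntropy (A + B) := by
  have hσ : σ.PosSemidef := by simpa using hAσ.add hA
  let k : ℝ := Fintype.card n
  have hr : Tendsto (fun t : ℝ => (1 + 2 * t * k) * Real.log ((1 + 2 * t * k) /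
      (σ.trace.re + 1 * t * k))) (𝓝[>] 0) (𝓝 (-Real.log σ.trace.re)) := by
    have hc : ContinuousAt (fun t : ℝ => (1 + 2 * t * k) * Real.log ((1 + 2 * t * k) /
      (σ.trace.re + 1 * t * k))) 0 := by
      refine ContinuousAt.mul (by fun_prop) (ContinuousAt.log (ContinuousAt.div (by fun_prop)
        (by fun_prop) ?_) ?_)
      · simpa using hσ0.ne'
      · simpa using hσ0.ne'
    have := hc.tendsto
    simp only [mul_zero, zero_mul, add_zero, one_mul, one_div, Real.log_inv] at this
    simpa using this.mono_left nhdsWithin_le_nhds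
  refine le_of_tendsto_of_tendsto hr (tendsto_lnEntropy_add_sub hA hB) ?_
  filter_upwards [self_mem_nhdsWithin] with t ht
  have ht0 : 0 < t := ht
  have ht' : 0 < 1 * t := by simpa using ht
  have hk : 0 ≤ k := Nat.cast_nonneg _
  have h := le_lnEntropy_add_sub_of_posDef (posDef_add_smul_one hA ht')
    (posDef_add_smul_one hB ht') (posDef_add_smul_one hσ ht')
    (by rwa [add_sub_add_right_eq_sub]) (by rwa [add_sub_add_right_eq_sub])
    (by rw [add_smul_one_add, re_trace_add_smul_one, hS]; positivity)
    (by rw [re_trace_add_smul_one]; positivity)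
  rwa [add_smul_one_add, re_trace_add_smul_one, re_trace_add_smul_one, hS] at h

/-- The optimal common upper bound `B + (A - B)₊` of `A` and `B` has trace
`(Tr (A + B) + ‖A - B‖₁) / 2`, the success probability of the optimal guess. -/
lemma exists_common_upper_bound {A B V : Matrix n n ℂ} (hV : V ∈ Matrix.unitaryGroup n ℂ)
    {e : n → ℝ} (he : A - B = V * Matrix.diagonal (fun i => (e i : ℂ)) * Vᴴ) :
    ∃ σ : Matrix n n ℂ, (σ - A).PosSemidef ∧ (σ - B).PosSemidef ∧
      σ.trace.re = ((A + B).trace.re + ∑ i, |e i|) / 2 := by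
  have pos : ∀ f : n → ℝ, (∀ i, 0 ≤ f i) →
      (V * Matrix.diagonal (fun i => (f i : ℂ)) * Vᴴ).PosSemidef := fun f hf =>
    (Matrix.PosSemidef.diagonal (fun i => by
      simpa using hf i)).mul_mul_conjTranspose_same V
  refine ⟨B + V * Matrix.diagonal (fun i => ((max (e i) 0 : ℝ) : ℂ)) * Vᴴ, ?_, ?_, ?_⟩
  · have : B + V * Matrix.diagonal (fun i => ((max (e i) 0 : ℝ) : ℂ)) * Vᴴ - A
        = V * Matrix.diagonal (fun i => ((max (e i) 0 - e i : ℝ) : ℂ)) * Vᴴ := by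
      rw [add_comm, add_sub_assoc, ← neg_sub A B, he, ← sub_eq_add_neg, ← sub_mul, ← mul_sub,
        Matrix.diagonal_sub]
      simp only [Complex.ofReal_sub]
    rw [this]
    exact pos _ fun i => sub_nonneg.2 (le_max_left _ _)
  · rw [add_sub_cancel_left]
    exact pos _ fun i => le_max_right _ _
  · have h := congrArg (fun M => (Matrix.trace M).re) he
    simp only [re_trace_conj_diagonal hV, Matrix.trace_sub, Complex.sub_re] at h
    rw [Matrix.trace_add, Matrix.trace_add, Complex.add_re, Complex.add_re,
      re_trace_conj_diagonal hV]
    have h2 : ∑ i, max (e i) 0 = (∑ i, e i + ∑ i, |e i|) / 2 := by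
      rw [← Finset.sum_add_distrib, Finset.sum_div]
      refine Finset.sum_congr rfl fun i _ => ?_
      rcases le_total (e i) 0 with h | h
      · rw [max_eq_right h, abs_of_nonpos h]; ring
      · rw [max_eq_left h, abs_of_nonneg h]; ring
    rw [h2]; linarith

end EntropyBounds

/-! ### Classical-quantum states of a bit and a quantum system -/

section CQ

variable {Y : Type*}

/-- The block-diagonal operator `|0⟩⟨0| ⊗ A + |1⟩⟨1| ⊗ B`; when `A` and `B` are positive
semidefinite with `Tr (A + B) = 1`, this is a state of a bit and a quantum system. -/
def cqState (A B : Matrix Y Y ℂ) : Matrix (ZMod 2 × Y) (ZMod 2 × Y) ℂ :=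
  Matrix.single 0 0 1 ⊗ₖ A + Matrix.single 1 1 1 ⊗ₖ B

lemma bit_cases : ∀ x : ZMod 2, x = 0 ∨ x = 1 := by decide

lemma cqState_apply (A B : Matrix Y Y ℂ) (x y : ZMod 2) (a b : Y) :
    cqState A B (x, a) (y, b) = if x = y then (if x = 0 then A a b else B a b) else 0 := by
  obtain rfl | rfl := bit_cases x <;> obtain rfl | rfl := bit_cases y <;>
    simp [cqState, Matrix.kroneckerMap_apply]

lemma conjTranspose_cqState (A B : Matrix Y Y ℂ) : (cqState A B)ᴴ = cqState Aᴴ Bᴴ := by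
  simp [cqState, Matrix.conjTranspose_kronecker]

lemma cqState_diagonal [DecidableEq Y] (a b : Y → ℂ) :
    cqState (Matrix.diagonal a) (Matrix.diagonal b)
      = Matrix.diagonal fun p => if p.1 = 0 then a p.2 else b p.2 := by
  ext ⟨x, i⟩ ⟨y, j⟩
  rw [cqState_apply, Matrix.diagonal_apply, Matrix.diagonal_apply, Matrix.diagonal_apply]
  by_cases hxy : x = y <;> by_cases hij : i = j <;> simp [hxy, hij]

lemma cqState_one [DecidableEq Y] : cqState (1 : Matrix Y Y ℂ) 1 = 1 := by
  rw [← Matrix.diagonal_one, cqState_diagonal]; simp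

lemma traceX_cqState (A B : Matrix Y Y ℂ) : traceX (cqState A B) = A + B := by
  ext a b
  rw [traceX, Matrix.of_apply, show (Finset.univ : Finset (ZMod 2)) = {0, 1} from rfl,
    Finset.sum_pair (by decide), cqState_apply, cqState_apply]
  simp

lemma diffOperator_cqState (A B : Matrix Y Y ℂ) : diffOperator (cqState A B) = A - B := by
  ext a b
  rw [diffOperator, Matrix.of_apply, cqState_apply, cqState_apply]
  simp

lemma isHermitian_traceX {X : Type*} [Fintype X] {ρ : Matrix (X × Y) (X × Y) ℂ}
    (hρ : ρ.IsHermitian) : (traceX ρ).IsHermitian := by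
  ext a b
  simp only [traceX, Matrix.conjTranspose_apply, Matrix.of_apply, star_sum]
  exact Finset.sum_congr rfl fun x _ => hρ.apply _ _

lemma isHermitian_diffOperator {ρ : Matrix (ZMod 2 × Y) (ZMod 2 × Y) ℂ} (hρ : ρ.IsHermitian) :
    (diffOperator ρ).IsHermitian := by
  ext a b
  simp only [diffOperator, Matrix.conjTranspose_apply, Matrix.of_apply, star_sub]
  rw [hρ.apply, hρ.apply]

lemma ofReal_re_diag {S : Matrix Y Y ℂ} (hS : S.IsHermitian) (i : Y) :
    ((S i i).re : ℂ) = S i i :=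
  Complex.conj_eq_iff_re.1 (hS.apply i i)

variable [Fintype Y]

lemma cqState_mul (A B A' B' : Matrix Y Y ℂ) :
    cqState A B * cqState A' B' = cqState (A * A') (B * B') := by
  simp [cqState, add_mul, mul_add, ← Matrix.mul_kronecker_mul]

lemma trace_cqState (A B : Matrix Y Y ℂ) : (cqState A B).trace = A.trace + B.trace := by
  simp [cqState, Matrix.trace_kronecker]

variable [DecidableEq Y]

lemma entropy_cqState {A B : Matrix Y Y ℂ} (hA : A.IsHermitian) (hB : B.IsHermitian) :
    entropy (cqState A B) = entropy A + entropy B := by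
  obtain ⟨V, hV, a, rfl⟩ := exists_spectral hA
  obtain ⟨U, hU, b, rfl⟩ := exists_spectral hB
  -- Eigenbases of the two blocks combine to an eigenbasis of the state.
  have hW : cqState V U ∈ Matrix.unitaryGroup (ZMod 2 × Y) ℂ := by
    rw [Matrix.mem_unitaryGroup_iff, Matrix.star_eq_conjTranspose, conjTranspose_cqState,
      cqState_mul, unitary_mul_conjTranspose hV, unitary_mul_conjTranspose hU, cqState_one]
  have h : cqState (V * Matrix.diagonal (fun i => (a i : ℂ)) * Vᴴ)
      (U * Matrix.diagonal (fun i => (b i : ℂ)) * Uᴴ)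
      = cqState V U * Matrix.diagonal (fun p => ((if p.1 = 0 then a p.2 else b p.2 : ℝ) : ℂ)) *
        (cqState V U)ᴴ := by
    rw [conjTranspose_cqState, ← cqState_mul, ← cqState_mul, cqState_diagonal]
    congr 3
    funext p
    split_ifs <;> rfl
  rw [h, entropy_conj_diagonal hW, entropy_conj_diagonal hV, entropy_conj_diagonal hU, ← add_div,
    Fintype.sum_prod_type, show (Finset.univ : Finset (ZMod 2)) = {0, 1} from rfl,
    Finset.sum_pair (by decide)]
  simp

lemma condEntropy_cqState {A B : Matrix Y Y ℂ} (hA : A.IsHermitian) (hB : B.IsHermitian) :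
    condEntropy (cqState A B)
      = (lnEntropy A + lnEntropy B - lnEntropy (A + B)) / Real.log 2 := by
  rw [condEntropy, entropy_cqState hA hB, traceX_cqState, entropy_eq_lnEntropy_div hA,
    entropy_eq_lnEntropy_div hB, entropy_eq_lnEntropy_div (hA.add hB)]
  ring

/-! ### The mean-squared error -/

/-- As `O_X² = 1`, the mean-squared error is `Tr S - 2 Tr (D M) + Tr (S M²)` for `S = A + B` and
`D = A - B`. -/
lemma mse_cqState (A B M : Matrix Y Y ℂ) :
    mse (cqState A B) M
      = (A + B).trace.re - 2 * ((A - B) * M).trace.re + ((A + B) * (M * M)).trace.re := by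
  have h : signObservable ⊗ₖ (1 : Matrix Y Y ℂ) - (1 : Matrix (ZMod 2) (ZMod 2) ℂ) ⊗ₖ M
      = cqState (1 - M) (-1 - M) := by
    ext ⟨x, a⟩ ⟨y, b⟩
    rw [cqState_apply]
    obtain rfl | rfl := bit_cases x <;> obtain rfl | rfl := bit_cases y <;>
      by_cases hab : a = b <;>
      simp [hab, signObservable, Matrix.kroneckerMap_apply]
  rw [mse, h, pow_two, cqState_mul, cqState_mul, trace_cqState]
  simp only [sub_mul, mul_sub, add_mul, mul_one, one_mul, neg_mul, mul_neg,
    Matrix.trace_sub, Matrix.trace_add, Matrix.trace_neg,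
    Complex.sub_re, Complex.add_re, Complex.neg_re]
  ring

lemma mse_nonneg {ρ : Matrix (ZMod 2 × Y) (ZMod 2 × Y) ℂ} (hρ : ρ.PosSemidef) {M : Matrix Y Y ℂ}
    (hM : M.IsHermitian) : 0 ≤ mse ρ M := by
  set K := signObservable ⊗ₖ (1 : Matrix Y Y ℂ) - (1 : Matrix (ZMod 2) (ZMod 2) ℂ) ⊗ₖ M with hK
  have hKH : Kᴴ = K := by
    simp [hK, Matrix.conjTranspose_sub, Matrix.conjTranspose_kronecker, signObservable, hM.eq]
  have h := (hρ.mul_mul_conjTranspose_same K).trace_nonneg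
  rw [hKH, mul_assoc, Matrix.trace_mul_comm, mul_assoc, ← pow_two] at h
  exact (Complex.le_def.1 h).1

lemma mmse_le_mse {ρ : Matrix (ZMod 2 × Y) (ZMod 2 × Y) ℂ} (hρ : ρ.PosSemidef) {M : Matrix Y Y ℂ}
    (hM : M.IsHermitian) : mmse ρ ≤ mse ρ M := by
  refine csInf_le ⟨0, ?_⟩ ⟨M, hM, rfl⟩
  rintro _ ⟨M', hM', rfl⟩
  exact mse_nonneg hρ hM'

lemma exists_isSpectralObservable {ρ : Matrix (ZMod 2 × Y) (ZMod 2 × Y) ℂ} (hρ : ρ.IsHermitian) :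
    ∃ M, IsSpectralObservable ρ M := by
  obtain ⟨V, hV, e, he⟩ := exists_spectral (isHermitian_diffOperator hρ)
  exact ⟨_, V, hV, e, he, rfl⟩

lemma IsSpectralObservable.isHermitian {ρ : Matrix (ZMod 2 × Y) (ZMod 2 × Y) ℂ}
    (hρ : ρ.IsHermitian) {M : Matrix Y Y ℂ} (hM : IsSpectralObservable ρ M) : M.IsHermitian := by
  obtain ⟨V, -, e, -, rfl⟩ := hM
  have hp := Matrix.isHermitian_conjTranspose_mul_mul V (isHermitian_traceX hρ)
  have h := isHermitian_conj_diagonal V fun i => e i / ((Vᴴ * traceX ρ * V) i i).re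
  simpa only [Complex.ofReal_div, ofReal_re_diag hp] using h

/-- The mean-squared error of a spectral observable is `1 - ∑ eᵢ² / pᵢ`, and the Cauchy–Schwarz
inequality bounds `∑ eᵢ² / pᵢ` from below by `(∑ |eᵢ|)²`. -/
lemma mse_le_of_isSpectralObservable {A B M : Matrix Y Y ℂ} (hA : A.PosSemidef)
    (hB : B.PosSemidef) (htr : (A + B).trace.re = 1)
    (hM : IsSpectralObservable (cqState A B) M) :
    ∃ V ∈ Matrix.unitaryGroup Y ℂ, ∃ e : Y → ℝ,
      A - B = V * Matrix.diagonal (fun i => (e i : ℂ)) * Vᴴ ∧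
      mse (cqState A B) M ≤ 1 - (∑ i, |e i|) ^ 2 := by
  obtain ⟨V, hV, e, he, rfl⟩ := hM
  rw [diffOperator_cqState] at he
  rw [traceX_cqState]
  refine ⟨V, hV, e, he, ?_⟩
  have hA' := hA.conjTranspose_mul_mul_same V
  have hB' := hB.conjTranspose_mul_mul_same V
  have hS' := (hA.add hB).conjTranspose_mul_mul_same V
  set p : Y → ℝ := fun i => ((Vᴴ * (A + B) * V) i i).re with hp
  have hpc : ∀ i, (Vᴴ * (A + B) * V) i i = (p i : ℂ) := fun i =>
    (ofReal_re_diag hS'.isHermitian i).symm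
  have hp0 : ∀ i, 0 ≤ p i := fun i => (Complex.le_def.1 hS'.diag_nonneg).1
  -- `pᵢ ± eᵢ` are diagonal entries of positive semidefinite matrices.
  have hep : ∀ i, p i = 0 → e i = 0 := by
    intro i hi
    have h1 : (e i : ℂ) = (Vᴴ * A * V) i i - (Vᴴ * B * V) i i := by
      rw [← Matrix.sub_apply, ← sub_mul, ← mul_sub, he, conj_diagonal_conj hV,
        Matrix.diagonal_apply_eq]
    have h2 : p i = ((Vᴴ * A * V) i i).re + ((Vᴴ * B * V) i i).re := by
      simp only [hp]
      rw [mul_add, add_mul, Matrix.add_apply, Complex.add_re]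
    have h3 := congrArg Complex.re h1
    rw [Complex.ofReal_re, Complex.sub_re] at h3
    have h4 : 0 ≤ ((Vᴴ * A * V) i i).re := (Complex.le_def.1 hA'.diag_nonneg).1
    have h5 : 0 ≤ ((Vᴴ * B * V) i i).re := (Complex.le_def.1 hB'.diag_nonneg).1
    linarith
  have hsum : ∑ i, p i = 1 := by
    rw [← htr, ← one_mul (A + B), ← unitary_mul_conjTranspose hV, mul_assoc,
      Matrix.trace_mul_comm, Matrix.trace, Complex.re_sum]
    rfl
  simp only [hpc]
  set q : Y → ℝ := fun i => e i / p i with hq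
  have hq' : ∀ i, (e i : ℂ) / (p i : ℂ) = (q i : ℂ) := fun i => by simp [hq]
  simp only [hq']
  have hDM : ((A - B) * (V * Matrix.diagonal (fun i => (q i : ℂ)) * Vᴴ)).trace.re
      = ∑ i, e i * q i := by
    rw [he, conj_diagonal_mul hV]
    simp only [← Complex.ofReal_mul]
    rw [re_trace_conj_diagonal hV]
  have hSM : ((A + B) * (V * Matrix.diagonal (fun i => (q i : ℂ)) * Vᴴ *
      (V * Matrix.diagonal (fun i => (q i : ℂ)) * Vᴴ))).trace.re = ∑ i, p i * (q i * q i) := by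
    rw [conj_diagonal_mul hV, ← mul_assoc, Matrix.trace_mul_comm, ← mul_assoc, ← mul_assoc,
      Matrix.trace, Complex.re_sum]
    refine Finset.sum_congr rfl fun i _ => ?_
    rw [Matrix.diag_apply, Matrix.mul_diagonal, hpc]
    simp only [← Complex.ofReal_mul, Complex.ofReal_re]
  -- At `pᵢ = 0` the quotient is `qᵢ = 0`, so the identity holds there too.
  have hpq : ∀ i, p i * (q i * q i) = e i * q i := fun i => by
    by_cases h0 : p i = 0
    · simp [hq, h0]
    · simp only [hq]; field_simp
  have hcs : (∑ i, |e i|) ^ 2 ≤ (∑ i, e i * q i) * ∑ i, p i := by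
    refine Finset.sum_sq_le_sum_mul_sum_of_sq_le_mul _ (fun i _ => ?_) (fun i _ => hp0 i)
      (fun i _ => le_of_eq ?_)
    · rw [← hpq]; exact mul_nonneg (hp0 i) (mul_self_nonneg _)
    · rw [sq_abs]
      by_cases h0 : p i = 0
      · simp [hep i h0]
      · simp only [hq]; field_simp
  rw [mse_cqState, hDM, hSM, htr, Finset.sum_congr rfl fun i _ => hpq i]
  rw [hsum, mul_one] at hcs
  linarith

/-- For a classical-quantum state of a bit, the conditional entropy is at most `1`, and there is
a number `g` (the success probability of the optimal guess of the bit) with `2 ^ (-H) ≤ g` and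
mean-squared error at most `4 g (1 - g)`. -/
lemma exists_guess {A B M : Matrix Y Y ℂ} (hA : A.PosSemidef)
    (hB : B.PosSemidef) (htr : (A + B).trace = 1)
    (hM : IsSpectralObservable (cqState A B) M) :
    condEntropy (cqState A B) ≤ 1 ∧
    ∃ g : ℝ, (2 : ℝ) ^ (-condEntropy (cqState A B)) ≤ g ∧
      mse (cqState A B) M ≤ 4 * g * (1 - g) := by
  have htr' : (A + B).trace.re = 1 := by rw [htr, Complex.one_re]
  have hl2 : 0 < Real.log 2 := Real.log_pos (by norm_num)
  rw [condEntropy_cqState hA.isHermitian hB.isHermitian]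
  refine ⟨?_, ?_⟩
  · have h := lnEntropy_add_sub_le hA hB
    rw [htr', mul_one] at h
    rwa [div_le_one hl2]
  obtain ⟨V, hV, e, he, hmse⟩ := mse_le_of_isSpectralObservable hA hB htr' hM
  obtain ⟨σ, hσA, hσB, hσ⟩ := exists_common_upper_bound hV he
  rw [htr'] at hσ
  have hpos : 0 < σ.trace.re := by
    have : 0 ≤ ∑ i, |e i| := Finset.sum_nonneg fun i _ => abs_nonneg _
    rw [hσ]; linarith
  refine ⟨σ.trace.re, ?_, ?_⟩
  · have h := le_lnEntropy_add_sub hA hB hσA hσB htr' hpos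
    rw [Real.rpow_def_of_pos (by norm_num), mul_neg, mul_div_cancel₀ _ hl2.ne',
      ← Real.le_log_iff_exp_le hpos]
    linarith
  · refine hmse.trans (le_of_eq ?_)
    rw [hσ]; ring

lemma mse_bounds {A B M : Matrix Y Y ℂ} (hA : A.PosSemidef)
    (hB : B.PosSemidef) (htr : (A + B).trace = 1)
    (hM : IsSpectralObservable (cqState A B) M) {H : ℝ} (hH : H = condEntropy (cqState A B)) :
    mse (cqState A B) M ≤ 4 * (2 : ℝ) ^ (-H) * (1 - (2 : ℝ) ^ (-H)) ∧
      ∀ δ : ℝ, 0 ≤ δ → H ≤ 1 - δ / Real.log 2 → mse (cqState A B) M ≤ 1 - δ ^ 2 := by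
  obtain ⟨hH1, g, hg, hmse⟩ := exists_guess hA hB htr hM
  rw [← hH] at hH1 hg
  have hl2 : 0 < Real.log 2 := Real.log_pos (by norm_num)
  -- `2 ^ (-H) ≥ exp δ / 2 ≥ (1 + δ) / 2`; the case `δ = 0` is `2 ^ (-H) ≥ 1 / 2`.
  have hlow : ∀ δ : ℝ, H ≤ 1 - δ / Real.log 2 → (1 + δ) / 2 ≤ (2 : ℝ) ^ (-H) := by
    intro δ hδ
    have h1 : (2 : ℝ) ^ (-(1 - δ / Real.log 2)) ≤ (2 : ℝ) ^ (-H) :=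
      Real.rpow_le_rpow_of_exponent_le (by norm_num) (by linarith)
    refine le_trans ?_ h1
    have h2 : Real.log 2 * -(1 - δ / Real.log 2) = δ - Real.log 2 := by field_simp; ring
    rw [Real.rpow_def_of_pos (by norm_num), h2, Real.exp_sub, Real.exp_log (by norm_num)]
    have := Real.add_one_le_exp δ
    linarith
  refine ⟨hmse.trans ?_, fun δ hδ0 hδ => hmse.trans ?_⟩
  · have := hlow 0 (by simpa using hH1)
    nlinarith [mul_nonneg (sub_nonneg.2 hg) (by linarith : 0 ≤ g + (2 : ℝ) ^ (-H) - 1)]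
  · have := (hlow δ hδ).trans hg
    nlinarith [mul_nonneg (by linarith : 0 ≤ 2 * g - 1 - δ) (by linarith : 0 ≤ 2 * g - 1 + δ)]

end CQ

/-! ### The extrinsic state of a linear code -/

section Extrinsic

lemma tensorFamily_mul {I J : Type*} [Fintype I] [DecidableEq I] [Fintype J]
    (A B : I → Matrix J J ℂ) :
    tensorFamily A * tensorFamily B = tensorFamily fun i => A i * B i := by
  ext a b
  simp only [tensorFamily, Matrix.mul_apply, Matrix.of_apply, ← Finset.prod_mul_distrib]
  exact (Fintype.prod_sum fun i j => A i (a i) j * B i j (b i)).symm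

lemma conjTranspose_tensorFamily {I J : Type*} [Fintype I] (A : I → Matrix J J ℂ) :
    (tensorFamily A)ᴴ = tensorFamily fun i => (A i)ᴴ := by
  ext a b
  simp [tensorFamily, Matrix.conjTranspose_apply]

lemma trace_tensorFamily {I J : Type*} [Fintype I] [DecidableEq I] [Fintype J]
    (A : I → Matrix J J ℂ) : (tensorFamily A).trace = ∏ i, (A i).trace :=
  (Fintype.prod_sum fun i j => A i j j).symm

lemma posSemidef_tensorFamily {I J : Type*} [Fintype I] [Fintype J] [DecidableEq J]
    {A : I → Matrix J J ℂ} (hA : ∀ i, (A i).PosSemidef) : (tensorFamily A).PosSemidef := by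
  classical
  choose B hB using fun i => exists_eq_conjTranspose_mul_self (hA i)
  rw [show A = fun i => (B i)ᴴ * B i from funext hB, ← tensorFamily_mul,
    ← conjTranspose_tensorFamily]
  exact Matrix.posSemidef_conjTranspose_mul_self _

variable {N d : ℕ} [NeZero N] {W : ZMod 2 → Matrix (Fin d) (Fin d) ℂ}

open Classical in
/-- The subnormalised state of `Y_{∼0}` on the event `X₀ = z`, which is the block
`⟨z|ρ_{X₀ Y_{∼0}}|z⟩` of the extrinsic state. -/
noncomputable def extrinsicBlock (W : ZMod 2 → Matrix (Fin d) (Fin d) ℂ)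
    (C : Submodule (ZMod 2) (Fin N → ZMod 2)) (z : ZMod 2) :
    Matrix (ExtrinsicIdx N d) (ExtrinsicIdx N d) ℂ :=
  (Nat.card C : ℂ)⁻¹ •
    ∑ x : Fin N → ZMod 2 with x ∈ C, if x 0 = z then extrinsicOutput W x else 0

lemma extrinsicState_eq_cqState (C : Submodule (ZMod 2) (Fin N → ZMod 2)) :
    extrinsicState W C = cqState (extrinsicBlock W C 0) (extrinsicBlock W C 1) := by
  classical
  ext ⟨x, a⟩ ⟨y, b⟩
  have hterm : ∀ c : Fin N → ZMod 2,
      Matrix.single (c 0) (c 0) (1 : ℂ) x y * extrinsicOutput W c a b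
        = if x = y then (if c 0 = x then extrinsicOutput W c else 0) a b else 0 := fun c => by
    rw [Matrix.single_apply]
    by_cases hxy : x = y <;> by_cases hc : c 0 = x <;> simp_all
  rw [cqState_apply]
  simp only [extrinsicState, extrinsicBlock, Matrix.smul_apply, Matrix.sum_apply,
    Matrix.kroneckerMap_apply, hterm]
  by_cases hxy : x = y
  · obtain rfl | rfl := bit_cases x <;> simp [← hxy]
  · simp [hxy]

lemma posSemidef_extrinsicBlock (hW : ∀ x, IsDensity (W x))
    (C : Submodule (ZMod 2) (Fin N → ZMod 2)) (z : ZMod 2) :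
    (extrinsicBlock W C z).PosSemidef := by
  refine Matrix.PosSemidef.smul (Matrix.posSemidef_sum _ fun x _ => ?_)
    (inv_nonneg.2 (Nat.cast_nonneg _))
  split_ifs
  · exact posSemidef_tensorFamily fun i => (hW _).1
  · exact Matrix.PosSemidef.zero

lemma trace_extrinsicBlock_add (hW : ∀ x, IsDensity (W x))
    (C : Submodule (ZMod 2) (Fin N → ZMod 2)) :
    (extrinsicBlock W C 0 + extrinsicBlock W C 1).trace = 1 := by
  classical
  have hx : ∀ x : Fin N → ZMod 2, ((if x 0 = 0 then extrinsicOutput W x else 0) +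
      if x 0 = 1 then extrinsicOutput W x else 0).trace = 1 := by
    intro x
    have h1 : (extrinsicOutput W x).trace = 1 := by
      rw [extrinsicOutput, trace_tensorFamily]
      exact Finset.prod_eq_one fun i _ => (hW _).2
    obtain h | h := bit_cases (x 0)
    · simp [h, h1]
    · simp [h, h1]
  have hcard : (Finset.univ.filter fun x : Fin N → ZMod 2 => x ∈ C).card = Nat.card C := by
    rw [Nat.card_eq_fintype_card, Fintype.card_subtype]
  rw [extrinsicBlock, extrinsicBlock, ← smul_add, ← Finset.sum_add_distrib, Matrix.trace_smul,
    Matrix.trace_sum, Finset.sum_congr rfl fun x _ => hx x, Finset.sum_const, hcard,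
    nsmul_eq_mul, mul_one, smul_eq_mul, inv_mul_cancel₀]
  exact_mod_cast Nat.card_pos.ne'

lemma posSemidef_extrinsicState (hW : ∀ x, IsDensity (W x))
    (C : Submodule (ZMod 2) (Fin N → ZMod 2)) : (extrinsicState W C).PosSemidef := by
  refine Matrix.PosSemidef.smul (Matrix.posSemidef_sum _ fun x _ => ?_)
    (inv_nonneg.2 (Nat.cast_nonneg _))
  refine Matrix.PosSemidef.kronecker ?_ (posSemidef_tensorFamily fun i => (hW _).1)
  rw [← Matrix.diagonal_single]
  exact Matrix.PosSemidef.diagonal (Pi.single_nonneg.2 zero_le_one)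

end Extrinsic
end RMCQ

theorem mainTheorem9 (d : ℕ) (W : ZMod 2 → Matrix (Fin d) (Fin d) ℂ) (hW : RMCQ.IsBSCQ W)
    (r m : ℕ) (ρ : Matrix (ZMod 2 × RMCQ.ExtrinsicIdx (2 ^ m) d)
      (ZMod 2 × RMCQ.ExtrinsicIdx (2 ^ m) d) ℂ)
    (hρ : ρ = RMCQ.extrinsicState W (RMCQ.reedMuller r m))
    (H : ℝ) (hH : H = RMCQ.condEntropy ρ) :
    (RMCQ.mmse ρ ≤ 4 * (2 : ℝ) ^ (-H) * (1 - (2 : ℝ) ^ (-H)) ∧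
      ∀ δ : ℝ, 0 ≤ δ → H ≤ 1 - δ / Real.log 2 → RMCQ.mmse ρ ≤ 1 - δ ^ 2) ∧
    (∀ M, RMCQ.IsSpectralObservable ρ M →
      RMCQ.mse ρ M ≤ 4 * (2 : ℝ) ^ (-H) * (1 - (2 : ℝ) ^ (-H)) ∧
      ∀ δ : ℝ, 0 ≤ δ → H ≤ 1 - δ / Real.log 2 → RMCQ.mse ρ M ≤ 1 - δ ^ 2) := by
  have hpsd : ρ.PosSemidef := hρ ▸ RMCQ.posSemidef_extrinsicState hW.density _
  rw [RMCQ.extrinsicState_eq_cqState] at hρ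
  have key := fun M (hM : RMCQ.IsSpectralObservable ρ M) => by
    rw [hρ] at hM hH
    exact RMCQ.mse_bounds (RMCQ.posSemidef_extrinsicBlock hW.density _ 0)
      (RMCQ.posSemidef_extrinsicBlock hW.density _ 1)
      (RMCQ.trace_extrinsicBlock_add hW.density _) hM hH
  rw [← hρ] at key
  refine ⟨?_, key⟩
  obtain ⟨M, hM⟩ := RMCQ.exists_isSpectralObservable hpsd.isHermitian
  have hle := RMCQ.mmse_le_mse hpsd (hM.isHermitian hpsd.isHermitian)
  exact ⟨hle.trans (key M hM).1, fun δ h0 h1 => hle.trans ((key M hM).2 δ h0 h1)⟩
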